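/- Let $H$ be a complex Hilbert space and let $\alpha\in[0,\pi/2)$. A linear operator $S$ in $H$ is called $m$-$\alpha$-sectorial if it is $m$-accretive (that is, densely defined and closed, with $\operatorname{Re}(Su,u)\ge 0$ for all $u\in\operatorname{dom}S$ and $\operatorname{Re}(S^*v,v)\ge 0$ for all $v\in\operatorname{dom}S^*$) and its numerical range $W(S)=\{(Su,u):u\in\operatorname{dom}S,\ \|u\|=1\}$ is contained in the sector $\{z\in\mathbb{C}:|\arg z|\le\alpha\}$ (which includes $z=0$). For $\alpha\in(0,\pi/2)$ let $C_H(\alpha)$ be the set of bounded operators $T$ on $H$ with $\|T\sin\alpha+ i\cos\alpha\, I\|\le 1$ and $\|T\sin\alpha- i\cos\alpha\, I\|\le 1$; let $C_H(0)$ be the set of self-adjoint contractions on $H$. A $C_0$-semigroup is a strongly continuous family $T(t)$, $t\ge 0$, of bounded operators on $H$ with $T(0)=I$ and $T(s+t)=T(s)T(t)$; its generator is the operator $Su=\lim_{t\to+0}(u-T(t)u)/t$, defined for all $u\in H$ for which the limit exists, and one writes $T(t)=\exp(-tS)$. 1. If $S$ is an $m$-$\alpha$-sectorial operator in $H$, then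 there is exactly one $C_0$-semigroup $T(t)=\exp(-tS)$, $t\ge0$, with generator $S$, and $T(t)\in C_H(\alpha)$ for all $t\ge 0$. 2. Conversely, let $T(t)=\exp(-tS)$, $t\ge 0$, be a $C_0$-semigroup of contractions on $H$ with generator $S$. If $T(t)\in C_H(\alpha)$ for all $t\ge 0$ in some neighborhood of $t=0$, then $S$ is $m$-$\alpha$-sectorial. -/

import Mathlib

open Filter Topology
open scoped NNReal

section OperatorDefs

variable {H : Type*} [NormedAddCommGroup H] [InnerProductSpace ℂ H]

/-- The numerical range `{(Au, u) : u ∈ dom A, ‖u‖ = 1}` of a (possibly unbounded) operator.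
Mathlib's inner product is linear in the second variable, so `(Au, u)` is `inner ℂ u (A u)`. -/
def numRange (A : H →ₗ.[ℂ] H) : Set ℂ :=
  {z | ∃ u : A.domain, ‖(u : H)‖ = 1 ∧ inner ℂ (u : H) (A u) = z}

/-- The closed sector `{z : |arg z| ≤ α}` with vertex `0` (which it contains) and semi-angle `α`. -/
def closedSector (α : ℝ) : Set ℂ := {z | |Complex.arg z| ≤ α}

/-- `Re (Su, u) ≥ 0` for all `u ∈ dom S`. -/
def IsAccretive (S : H →ₗ.[ℂ] H) : Prop :=
  ∀ u : S.domain, 0 ≤ (inner ℂ (u : H) (S u)).re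

/-- An accretive operator is `m`-accretive if it is densely defined and closed and its adjoint
is accretive. -/
structure IsMAccretive [CompleteSpace H] (S : H →ₗ.[ℂ] H) : Prop where
  accretive : IsAccretive S
  dense_domain : Dense (S.domain : Set H)
  closed : S.IsClosed
  adjoint_accretive : IsAccretive S.adjoint

/-- `m`-`α`-sectorial operators with vertex `0`. -/
structure IsMSectorial [CompleteSpace H] (α : ℝ) (S : H →ₗ.[ℂ] H) : Prop where
  mAccretive : IsMAccretive S
  numRange_subset : numRange S ⊆ closedSector α

/-- The class `C_H(α)` of bounded operators: for `α ≠ 0` it is given by the two norm inequalities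
`‖T sin α ± i cos α I‖ ≤ 1`; for `α = 0` it is, by convention, the set of all self-adjoint
contractions. -/
def classC [CompleteSpace H] (α : ℝ) : Set (H →L[ℂ] H) :=
  {T | if α = 0 then IsSelfAdjoint T ∧ ‖T‖ ≤ 1 else
    ‖(Real.sin α : ℂ) • T + (Complex.I * (Real.cos α : ℂ)) • ContinuousLinearMap.id ℂ H‖ ≤ 1 ∧
    ‖(Real.sin α : ℂ) • T - (Complex.I * (Real.cos α : ℂ)) • ContinuousLinearMap.id ℂ H‖ ≤ 1}

/-- Strongly continuous one-parameter semigroups of bounded operators. -/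
structure IsC0Semigroup (T : ℝ≥0 → H →L[ℂ] H) : Prop where
  map_zero : T 0 = ContinuousLinearMap.id ℂ H
  map_add : ∀ s t : ℝ≥0, T (s + t) = (T s).comp (T t)
  strongly_continuous : ∀ u : H, Continuous fun t : ℝ≥0 => T t u

/-- The vector `v` is the limit of `(u - T(t)u) / t` as `t → 0+`. -/
def HasGeneratorValue (T : ℝ≥0 → H →L[ℂ] H) (u v : H) : Prop :=
  Tendsto (fun t : ℝ≥0 => (t : ℝ)⁻¹ • (u - T t u)) (𝓝[>] (0 : ℝ≥0)) (𝓝 v)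

theorem HasGeneratorValue.unique {T : ℝ≥0 → H →L[ℂ] H} {u v w : H}
    (hv : HasGeneratorValue T u v) (hw : HasGeneratorValue T u w) : v = w :=
  tendsto_nhds_unique hv hw

theorem HasGeneratorValue.add {T : ℝ≥0 → H →L[ℂ] H} {u u' v v' : H}
    (h : HasGeneratorValue T u v) (h' : HasGeneratorValue T u' v') :
    HasGeneratorValue T (u + u') (v + v') := by
  refine (Tendsto.add h h').congr fun t => ?_
  rw [← smul_add, _root_.map_add]
  congr 1
  abel

theorem HasGeneratorValue.smul {T : ℝ≥0 → H →L[ℂ] H} {u v : H} (c : ℂ)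
    (h : HasGeneratorValue T u v) : HasGeneratorValue T (c • u) (c • v) := by
  refine (Tendsto.const_smul h c).congr fun t => ?_
  rw [_root_.map_smul, ← smul_sub, smul_comm]

theorem HasGeneratorValue.zero (T : ℝ≥0 → H →L[ℂ] H) : HasGeneratorValue T 0 0 := by
  simp [HasGeneratorValue]

/-- The generator `S` of the family `T(t) = exp(-tS)`: `Su = lim_{t → 0+} (u - T(t)u) / t`, with
domain the set of all `u` for which this limit exists. -/
noncomputable def semigroupGenerator (T : ℝ≥0 → H →L[ℂ] H) : H →ₗ.[ℂ] H where
  domain :=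
    { carrier := {u | ∃ v, HasGeneratorValue T u v}
      add_mem' := fun ⟨v, hv⟩ ⟨w, hw⟩ => ⟨v + w, hv.add hw⟩
      zero_mem' := ⟨0, HasGeneratorValue.zero T⟩
      smul_mem' := fun c _ ⟨v, hv⟩ => ⟨c • v, hv.smul c⟩ }
  toFun :=
    { toFun := fun u => Classical.choose u.2
      map_add' := fun u w => (Classical.choose_spec (u + w).2).unique
        ((Classical.choose_spec u.2).add (Classical.choose_spec w.2))
      map_smul' := fun c u => (Classical.choose_spec (c • u).2).unique
        ((Classical.choose_spec u.2).smul c) }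

theorem hasGeneratorValue_semigroupGenerator (T : ℝ≥0 → H →L[ℂ] H)
    (u : (semigroupGenerator T).domain) :
    HasGeneratorValue T (u : H) (semigroupGenerator T u) :=
  Classical.choose_spec u.2

end OperatorDefs

/-! ### The sector and the class `classC` as quadratic inequalities. -/

section Sector

variable {H : Type*} [NormedAddCommGroup H] [InnerProductSpace ℂ H]

/-! With k = tan α, both sides of the theorem are quadratic inequalities. For accretive S,
sectoriality says |Im (Su,u)| ≤ k Re (Su,u). For a contraction L, membership in the class says 2|Im
(Lu,u)| ≤ k(‖u‖² - ‖Lu‖²) (`mem_classC_iff`). The second inequality integrates the first along the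
semigroup, and the first is the derivative of the second at t = 0.

Integration (`two_mul_abs_im_inner_le`): for an orbit x(s) = T(s)u, compare x(s) with the reversed
orbit x(t - s). The function ± Im of their inner product plus k/2 (‖x(s)‖² - ‖x(t - s)‖²) is
nonincreasing in s, by a polarised form of sectoriality, and its two end values give the claim.
Density of the domain extends it to all u.

Differentiation: since ‖Lu‖² = ‖u‖² - 2 Re (u - Lu, u) + ‖u - Lu‖², the class inequality yields |Im
(u - Lu, u)| ≤ k Re (u - Lu, u). Take L = T(t), divide by t and let t → 0.

The rest is the correspondence between m-accretive operators and contraction semigroups: existence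
by Yosida approximation (`IsMAccretive.exists_isC0Semigroup`), uniqueness by decay of the difference
of two orbits, and m-accretivity of the generator by time averages of orbits. -/

theorem mem_closedSector_iff {α : ℝ} (hα₀ : 0 ≤ α) (hα₁ : α < Real.pi / 2) {z : ℂ}
    (hre : 0 ≤ z.re) : z ∈ closedSector α ↔ |z.im| ≤ Real.tan α * z.re := by
  have hmem : α ∈ Set.Ioo (-(Real.pi / 2)) (Real.pi / 2) := ⟨by linarith [Real.pi_pos], hα₁⟩
  have hmem' : -α ∈ Set.Ioo (-(Real.pi / 2)) (Real.pi / 2) := ⟨by linarith, by linarith⟩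
  change |Complex.arg z| ≤ α ↔ _
  rcases hre.lt_or_eq with hre | hre
  · have hargmem := abs_lt.1 (Complex.abs_arg_lt_pi_div_two_iff.2 (Or.inl hre))
    rw [abs_le, abs_le, ← Real.strictMonoOn_tan.le_iff_le hmem' hargmem,
      ← Real.strictMonoOn_tan.le_iff_le hargmem hmem, Complex.tan_arg, Real.tan_neg,
      le_div_iff₀ hre, div_le_iff₀ hre, neg_mul]
  · refine ⟨fun h => ?_, fun h => ?_⟩
    · rcases Complex.abs_arg_lt_pi_div_two_iff.1 (h.trans_lt hα₁) with h | h
      · exact absurd hre h.ne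
      · simp [h]
    · have him : z.im = 0 := by simpa [← hre] using h
      have : z = 0 := Complex.ext hre.symm him
      simpa [this] using hα₀

theorem IsAccretive.numRange_subset_closedSector_iff {α : ℝ} (hα₀ : 0 ≤ α)
    (hα₁ : α < Real.pi / 2) {S : H →ₗ.[ℂ] H} (hS : IsAccretive S) :
    numRange S ⊆ closedSector α ↔
      ∀ u : S.domain, |(inner ℂ (u : H) (S u)).im| ≤
        Real.tan α * (inner ℂ (u : H) (S u)).re := by
  constructor
  · intro h u
    rcases eq_or_ne (u : H) 0 with hu | hu
    · simp [hu]
    · have hn : ‖(u : H)‖ ≠ 0 := norm_ne_zero_iff.2 hu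
      set c : ℂ := ((‖(u : H)‖⁻¹ : ℝ) : ℂ) with hc
      have hmem : inner ℂ ((c • u : S.domain) : H) (S (c • u)) ∈ numRange S :=
        ⟨c • u, by simp [hc, norm_smul, hn], rfl⟩
      have := (mem_closedSector_iff hα₀ hα₁ (hS (c • u))).1 (h hmem)
      have hval : inner ℂ ((c • u : S.domain) : H) (S (c • u)) =
          ((‖(u : H)‖⁻¹ ^ 2 : ℝ) : ℂ) * inner ℂ (u : H) (S u) := by
        rw [LinearPMap.map_smul, Submodule.coe_smul, inner_smul_left, inner_smul_right, hc,
          Complex.conj_ofReal]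
        push_cast
        ring
      rw [hval, Complex.re_ofReal_mul, Complex.im_ofReal_mul, abs_mul, abs_of_nonneg (by positivity),
        mul_left_comm] at this
      exact le_of_mul_le_mul_left this (by positivity)
  · rintro h z ⟨u, -, rfl⟩
    exact (mem_closedSector_iff hα₀ hα₁ (hS u)).2 (h u)

/-- Expansion of the squared norm. The coefficient `c` may have either sign, so this serves both
inequalities in `classC`. -/
theorem norm_smul_add_I_smul_le_one_iff (T : H →L[ℂ] H) (s c : ℝ) :
    ‖(s : ℂ) • T + (Complex.I * (c : ℂ)) • ContinuousLinearMap.id ℂ H‖ ≤ 1 ↔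
      ∀ u : H, s ^ 2 * ‖T u‖ ^ 2 + c ^ 2 * ‖u‖ ^ 2 + 2 * (s * c * (inner ℂ u (T u)).im) ≤
        ‖u‖ ^ 2 := by
  rw [ContinuousLinearMap.opNorm_le_iff zero_le_one]
  refine forall_congr' fun u => ?_
  rw [one_mul, ← sq_le_sq₀ (norm_nonneg _) (norm_nonneg _)]
  simp only [_root_.add_apply, _root_.smul_apply, ContinuousLinearMap.id_apply]
  rw [@norm_add_sq ℂ, inner_smul_left, inner_smul_right, norm_smul, norm_smul, mul_pow, mul_pow,
    Complex.conj_ofReal, ← inner_conj_symm (T u) u]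
  simp only [norm_mul, Complex.norm_I, Complex.norm_real, Real.norm_eq_abs, one_mul, sq_abs]
  have : RCLike.re ((s : ℂ) * (Complex.I * c * (starRingEnd ℂ) (inner ℂ u (T u)))) =
      s * c * (inner ℂ u (T u)).im := by
    rw [mul_comm Complex.I, mul_assoc, ← mul_assoc, ← Complex.ofReal_mul, RCLike.re_to_complex,
      Complex.re_ofReal_mul, Complex.I_mul_re, Complex.conj_im, neg_neg]
  rw [this]
  constructor <;> intro h <;> linarith

/-- Since sin² + cos² = 1, one factor sin α cancels from each expanded norm inequality, and the two
signs combine into the absolute value. For α = 0 the right side vanishes, which says that the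
quadratic form of T is real. -/
theorem mem_classC_iff [CompleteSpace H] {α : ℝ} (hα₀ : 0 ≤ α) (hα₁ : α < Real.pi / 2)
    {T : H →L[ℂ] H} (hT : ‖T‖ ≤ 1) :
    T ∈ classC α ↔
      ∀ u : H, 2 * |(inner ℂ u (T u)).im| ≤ Real.tan α * (‖u‖ ^ 2 - ‖T u‖ ^ 2) := by
  rcases hα₀.eq_or_lt with rfl | hα
  · simp only [classC, Set.mem_ofPred_eq, if_true, hT, and_true, Real.tan_zero, zero_mul]
    rw [ContinuousLinearMap.isSelfAdjoint_iff_isSymmetric,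
      LinearMap.isSymmetric_iff_inner_map_self_real]
    refine forall_congr' fun u => ?_
    rw [ContinuousLinearMap.coe_coe, ← inner_conj_symm (T u) u, Complex.conj_conj, eq_comm,
      Complex.conj_eq_iff_im]
    constructor
    · intro h
      simp [h]
    · intro h
      have := abs_nonneg (inner ℂ u (T u)).im
      exact abs_eq_zero.1 (by linarith)
  · have hs : 0 < Real.sin α := Real.sin_pos_of_pos_of_lt_pi hα (by linarith [Real.pi_pos])
    have hc : 0 < Real.cos α := Real.cos_pos_of_mem_Ioo ⟨by linarith [Real.pi_pos], hα₁⟩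
    have hsc := Real.sin_sq_add_cos_sq α
    have hminus : (Real.sin α : ℂ) • T - (Complex.I * (Real.cos α : ℂ)) •
        ContinuousLinearMap.id ℂ H = (Real.sin α : ℂ) • T + (Complex.I * ((-Real.cos α : ℝ) : ℂ)) •
        ContinuousLinearMap.id ℂ H := by
      rw [Complex.ofReal_neg, mul_neg, neg_smul, sub_eq_add_neg]
    simp only [classC, Set.mem_ofPred_eq, hα.ne', if_false]
    rw [hminus, norm_smul_add_I_smul_le_one_iff, norm_smul_add_I_smul_le_one_iff, ← forall_and]
    refine forall_congr' fun u => ?_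
    rw [Real.tan_eq_sin_div_cos, div_mul_eq_mul_div, le_div_iff₀ hc]
    have hkey : ∀ x : ℝ, Real.sin α ^ 2 * ‖T u‖ ^ 2 + Real.cos α ^ 2 * ‖u‖ ^ 2 +
        2 * (Real.sin α * x) ≤ ‖u‖ ^ 2 ↔ 2 * x ≤ Real.sin α * (‖u‖ ^ 2 - ‖T u‖ ^ 2) := by
      intro x
      have : ‖u‖ ^ 2 = Real.sin α ^ 2 * ‖u‖ ^ 2 + Real.cos α ^ 2 * ‖u‖ ^ 2 := by
        rw [← add_mul, hsc, one_mul]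
      rw [← mul_le_mul_iff_of_pos_left hs (b := 2 * x)]
      constructor <;> intro h <;> linarith
    rw [mul_assoc, hkey, neg_sq, mul_neg, neg_mul, mul_assoc, ← mul_neg, hkey]
    rcases abs_cases (inner ℂ u (T u)).im with ⟨h, h'⟩ | ⟨h, h'⟩ <;> rw [h] <;> constructor
    · rintro ⟨h1, -⟩; linarith
    · intro h1; constructor <;> nlinarith
    · rintro ⟨-, h1⟩; linarith
    · intro h1; constructor <;> nlinarith

end Sector

/-! ### Derivatives of inner products along curves. -/

section Calculus

variable {H : Type*} [NormedAddCommGroup H] [InnerProductSpace ℂ H]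

theorem HasDerivAt.inner_re {f g : ℝ → H} {f' g' : H} {x : ℝ} (hf : HasDerivAt f f' x)
    (hg : HasDerivAt g g' x) :
    HasDerivAt (fun t => (Inner.inner ℂ (f t) (g t)).re)
      ((Inner.inner ℂ (f x) g').re + (Inner.inner ℂ f' (g x)).re) x := by
  have h := Complex.reCLM.hasFDerivAt.comp_hasDerivAt x (HasDerivAt.inner ℂ hf hg)
  rw [map_add] at h
  exact h

theorem HasDerivAt.inner_im {f g : ℝ → H} {f' g' : H} {x : ℝ} (hf : HasDerivAt f f' x)
    (hg : HasDerivAt g g' x) :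
    HasDerivAt (fun t => (Inner.inner ℂ (f t) (g t)).im)
      ((Inner.inner ℂ (f x) g').im + (Inner.inner ℂ f' (g x)).im) x := by
  have h := Complex.imCLM.hasFDerivAt.comp_hasDerivAt x (HasDerivAt.inner ℂ hf hg)
  rw [map_add] at h
  exact h

theorem HasDerivAt.complex_norm_sq {f : ℝ → H} {f' : H} {x : ℝ} (hf : HasDerivAt f f' x) :
    HasDerivAt (fun t => ‖f t‖ ^ 2) (2 * (Inner.inner ℂ (f x) f').re) x := by
  have h := hf.inner_re hf
  have he : (fun t => ‖f t‖ ^ 2) = fun t => (Inner.inner ℂ (f t) (f t)).re := by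
    funext t
    exact norm_sq_eq_re_inner (𝕜 := ℂ) (f t)
  rw [he]
  convert h using 1
  rw [← inner_conj_symm f', Complex.conj_re, two_mul]

theorem norm_le_of_re_inner_deriv_nonpos {f f' : ℝ → H} {b : ℝ} (hb : 0 ≤ b)
    (hf : ContinuousOn f (Set.Icc 0 b)) (hf' : ∀ x ∈ Set.Ioo 0 b, HasDerivAt f (f' x) x)
    (hneg : ∀ x ∈ Set.Ioo 0 b, (Inner.inner ℂ (f x) (f' x)).re ≤ 0) : ‖f b‖ ≤ ‖f 0‖ := by
  have hanti : AntitoneOn (fun t => ‖f t‖ ^ 2) (Set.Icc 0 b) := by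
    refine antitoneOn_of_deriv_nonpos (convex_Icc 0 b) (hf.norm.pow 2) ?_ ?_
    · rw [interior_Icc]
      exact fun x hx => (hf' x hx).complex_norm_sq.differentiableAt.differentiableWithinAt
    · rw [interior_Icc]
      intro x hx
      rw [(hf' x hx).complex_norm_sq.deriv]
      linarith [hneg x hx]
  exact (sq_le_sq₀ (norm_nonneg _) (norm_nonneg _)).1
    (hanti (Set.left_mem_Icc.2 hb) (Set.right_mem_Icc.2 hb) hb)

end Calculus

/-! ### Orbits of a semigroup, uniqueness, and the class inequality. -/

section Semigroup

variable {H : Type*} [NormedAddCommGroup H] [InnerProductSpace ℂ H]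

theorem IsAccretive.re_inner_nonneg {S : H →ₗ.[ℂ] H} (hS : IsAccretive S) {u v : H}
    (h : (u, v) ∈ S.graph) : 0 ≤ (inner ℂ u v).re := by
  obtain ⟨y, rfl, rfl⟩ := (LinearPMap.mem_graph_iff S).1 h
  exact hS y

theorem mem_graph_semigroupGenerator_iff {T : ℝ≥0 → H →L[ℂ] H} {u v : H} :
    (u, v) ∈ (semigroupGenerator T).graph ↔ HasGeneratorValue T u v := by
  rw [LinearPMap.mem_graph_iff]
  constructor
  · rintro ⟨y, hy, rfl⟩
    dsimp only at hy ⊢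
    simpa only [hy] using hasGeneratorValue_semigroupGenerator T y
  · intro h
    exact ⟨⟨u, v, h⟩, rfl, (hasGeneratorValue_semigroupGenerator T ⟨u, v, h⟩).unique h⟩

theorem tendsto_toNNReal_nhdsGT_zero : Tendsto Real.toNNReal (𝓝[>] 0) (𝓝[>] 0) := by
  refine tendsto_nhdsWithin_iff.2 ⟨?_, ?_⟩
  · have := (continuous_real_toNNReal.tendsto (0 : ℝ)).mono_left (nhdsWithin_le_nhds (s := Set.Ioi 0))
    simpa using this
  · filter_upwards [self_mem_nhdsWithin] with x hx
    simpa using hx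

theorem tendsto_coe_nhdsGT_zero : Tendsto (fun t : ℝ≥0 => (t : ℝ)) (𝓝[>] 0) (𝓝[>] 0) := by
  refine tendsto_nhdsWithin_iff.2 ⟨?_, ?_⟩
  · have := (NNReal.continuous_coe.tendsto (0 : ℝ≥0)).mono_left
      (nhdsWithin_le_nhds (s := Set.Ioi 0))
    simpa using this
  · filter_upwards [self_mem_nhdsWithin] with x hx
    simpa using hx

namespace IsC0Semigroup

variable {T : ℝ≥0 → H →L[ℂ] H} {u v : H}

theorem commute_apply (hT : IsC0Semigroup T) (s t : ℝ≥0) (u : H) :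
    T s (T t u) = T t (T s u) := by
  rw [← ContinuousLinearMap.comp_apply, ← ContinuousLinearMap.comp_apply, ← hT.map_add,
    ← hT.map_add, add_comm]

theorem continuous_orbit (hT : IsC0Semigroup T) (u : H) :
    Continuous fun s : ℝ => T s.toNNReal u :=
  (hT.strongly_continuous u).comp continuous_real_toNNReal

theorem hasGeneratorValue_apply (hT : IsC0Semigroup T) (h : HasGeneratorValue T u v) (t : ℝ≥0) :
    HasGeneratorValue T (T t u) (T t v) := by
  refine (((T t).continuous.tendsto v).comp h).congr fun s => ?_
  simp only [Function.comp_apply]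
  rw [hT.commute_apply s t u, ← map_sub, ContinuousLinearMap.map_smul_of_tower]

theorem hasDerivWithinAt_orbit (hT : IsC0Semigroup T) (h : HasGeneratorValue T u v) {t : ℝ}
    (ht : 0 ≤ t) :
    HasDerivWithinAt (fun s : ℝ => T s.toNNReal u) (-T t.toNNReal v) (Set.Ioi t) t := by
  have h1 := (hT.hasGeneratorValue_apply h t.toNNReal).comp tendsto_toNNReal_nhdsGT_zero
  have h2 : Tendsto (fun x : ℝ => x - t) (𝓝[>] t) (𝓝[>] 0) := by
    refine tendsto_nhdsWithin_iff.2 ⟨?_, ?_⟩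
    · have : Tendsto (fun x : ℝ => x - t) (𝓝 t) (𝓝 (t - t)) := by
        exact (continuous_id.sub continuous_const).tendsto t
      rw [sub_self] at this
      exact this.mono_left nhdsWithin_le_nhds
    · filter_upwards [self_mem_nhdsWithin] with x hx
      simpa using hx
  rw [hasDerivWithinAt_iff_tendsto_slope' (by simp)]
  refine (h1.comp h2).neg.congr' ?_
  filter_upwards [self_mem_nhdsWithin] with x hx
  have hx' : 0 ≤ x - t := sub_nonneg.2 (le_of_lt hx)
  have hadd : T x.toNNReal u = T (x - t).toNNReal (T t.toNNReal u) := by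
    rw [← ContinuousLinearMap.comp_apply, ← hT.map_add, ← Real.toNNReal_add hx' ht, sub_add_cancel]
  simp only [Function.comp_apply, slope, vsub_eq_sub]
  rw [Real.coe_toNNReal _ hx', hadd, ← smul_neg, neg_sub]

variable [CompleteSpace H]

/-- The semigroup law gives only a right derivative of the orbit directly. This suffices for the
fundamental theorem of calculus; differentiating the resulting integral then gives the two-sided
derivative in `hasDerivAt_orbit`. -/
theorem integral_orbit (hT : IsC0Semigroup T) (h : HasGeneratorValue T u v) {t : ℝ} (ht : 0 ≤ t) :
    ∫ s in (0 : ℝ)..t, T s.toNNReal v = u - T t.toNNReal u := by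
  have := intervalIntegral.integral_eq_sub_of_hasDeriv_right
    (f := fun s : ℝ => T s.toNNReal u) (f' := fun s : ℝ => -T s.toNNReal v) (a := 0) (b := t)
    (hT.continuous_orbit u).continuousOn
    (fun x hx => hT.hasDerivWithinAt_orbit h (by simpa [ht] using hx.1.le))
    ((hT.continuous_orbit v).neg.intervalIntegrable _ _)
  rw [intervalIntegral.integral_neg, Real.toNNReal_zero, hT.map_zero] at this
  rw [ContinuousLinearMap.id_apply] at this
  rw [← neg_sub, ← this, neg_neg]

theorem hasDerivAt_orbit (hT : IsC0Semigroup T) (h : HasGeneratorValue T u v) {t : ℝ}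
    (ht : 0 < t) : HasDerivAt (fun s : ℝ => T s.toNNReal u) (-T t.toNNReal v) t := by
  have h1 : HasDerivAt (fun t : ℝ => u - ∫ s in (0 : ℝ)..t, T s.toNNReal v)
      (-T t.toNNReal v) t :=
    ((hT.continuous_orbit v).integral_hasStrictDerivAt 0 t).hasDerivAt.const_sub u
  refine h1.congr_of_eventuallyEq ?_
  filter_upwards [eventually_gt_nhds ht] with x hx
  rw [hT.integral_orbit h hx.le, sub_sub_cancel]

/-- T(h) shifts the interval of integration, so only its two ends, each of length h, survive in the
difference quotient. -/
theorem hasGeneratorValue_integral (hT : IsC0Semigroup T) (u : H) {t : ℝ} (ht : 0 ≤ t) :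
    HasGeneratorValue T (∫ s in (0 : ℝ)..t, T s.toNNReal u) (u - T t.toNNReal u) := by
  have hcont := hT.continuous_orbit u
  have hd := fun x : ℝ =>
    ((hcont.integral_hasStrictDerivAt 0 x).hasDerivAt.tendsto_slope_zero_right).comp
      tendsto_coe_nhdsGT_zero
  have h0 := hd 0
  rw [Real.toNNReal_zero, hT.map_zero, ContinuousLinearMap.id_apply] at h0
  refine (h0.sub (hd t)).congr fun h => ?_
  simp only [Function.comp_apply, intervalIntegral.integral_same, sub_zero, zero_add]
  rw [← smul_sub]
  congr 1
  have hshift : T h (∫ s in (0 : ℝ)..t, T s.toNNReal u) =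
      ∫ s in (h : ℝ)..t + h, T s.toNNReal u := by
    rw [← (T h).intervalIntegral_comp_comm (hcont.intervalIntegrable _ _)]
    have := intervalIntegral.integral_comp_add_right (a := 0) (b := t)
      (fun s : ℝ => T s.toNNReal u) (h : ℝ)
    rw [zero_add] at this
    rw [← this]
    refine intervalIntegral.integral_congr fun s hs => ?_
    rw [Set.uIcc_of_le ht] at hs
    rw [Real.toNNReal_add hs.1 h.coe_nonneg, Real.toNNReal_coe, add_comm, hT.map_add,
      ContinuousLinearMap.comp_apply]
  rw [hshift, ← intervalIntegral.integral_add_adjacent_intervals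
    (hcont.intervalIntegrable 0 h) (hcont.intervalIntegrable h (t + h))]
  abel

/-- Two semigroup orbits starting at the same point of the domain of an accretive generator
coincide. -/
theorem apply_eq_of_hasGeneratorValue {U : ℝ≥0 → H →L[ℂ] H} (hT : IsC0Semigroup T)
    (hU : IsC0Semigroup U) (hTU : semigroupGenerator T = semigroupGenerator U)
    (hacc : IsAccretive (semigroupGenerator T)) (h : HasGeneratorValue T u v) (t : ℝ≥0) :
    T t u = U t u := by
  have hU' : HasGeneratorValue U u v := by
    rwa [← mem_graph_semigroupGenerator_iff, ← hTU, mem_graph_semigroupGenerator_iff]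
  -- The difference of the orbits starts at 0, and accretivity keeps its norm from growing.
  have key := norm_le_of_re_inner_deriv_nonpos
    (f := fun s : ℝ => T s.toNNReal u - U s.toNNReal u)
    (f' := fun s : ℝ => -T s.toNNReal v - -U s.toNNReal v) t.coe_nonneg
    ((hT.continuous_orbit u).sub (hU.continuous_orbit u)).continuousOn
    (fun x hx => (hT.hasDerivAt_orbit h hx.1).sub (hU.hasDerivAt_orbit hU' hx.1))
    (fun x _ => by
      have h1 := mem_graph_semigroupGenerator_iff.2 (hT.hasGeneratorValue_apply h x.toNNReal)
      have h2 := mem_graph_semigroupGenerator_iff.2 (hU.hasGeneratorValue_apply hU' x.toNNReal)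
      rw [← hTU] at h2
      have h3 := hacc.re_inner_nonneg (Submodule.sub_mem _ h1 h2)
      rw [← neg_sub', inner_neg_right, Complex.neg_re]
      linarith)
  simp only [Real.toNNReal_coe, Real.toNNReal_zero, hT.map_zero, hU.map_zero, sub_self,
    norm_zero] at key
  exact sub_eq_zero.1 (norm_le_zero_iff.1 key)

theorem norm_apply_le_of_isAccretive (hT : IsC0Semigroup T)
    (hacc : IsAccretive (semigroupGenerator T)) (h : HasGeneratorValue T u v) (t : ℝ≥0) :
    ‖T t u‖ ≤ ‖u‖ := by
  have key := norm_le_of_re_inner_deriv_nonpos (f := fun s : ℝ => T s.toNNReal u)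
    (f' := fun s : ℝ => -T s.toNNReal v) t.coe_nonneg (hT.continuous_orbit u).continuousOn
    (fun x hx => hT.hasDerivAt_orbit h hx.1)
    (fun x _ => by
      have := hacc.re_inner_nonneg
        (mem_graph_semigroupGenerator_iff.2 (hT.hasGeneratorValue_apply h x.toNNReal))
      rw [inner_neg_right, Complex.neg_re]
      linarith)
  simpa only [Real.toNNReal_coe, Real.toNNReal_zero, hT.map_zero,
    ContinuousLinearMap.id_apply] using key

theorem norm_le_one_of_isAccretive (hT : IsC0Semigroup T)
    (hacc : IsAccretive (semigroupGenerator T))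
    (hdense : Dense ((semigroupGenerator T).domain : Set H)) (t : ℝ≥0) : ‖T t‖ ≤ 1 := by
  refine ContinuousLinearMap.opNorm_le_bound _ zero_le_one fun u => ?_
  rw [one_mul]
  refine hdense.induction (P := fun u => ‖T t u‖ ≤ ‖u‖)
    (fun u ⟨v, hv⟩ => hT.norm_apply_le_of_isAccretive hacc hv t)
    (isClosed_le (T t).continuous.norm continuous_norm) u

theorem ext_of_semigroupGenerator_eq {U : ℝ≥0 → H →L[ℂ] H} (hT : IsC0Semigroup T)
    (hU : IsC0Semigroup U) (hTU : semigroupGenerator T = semigroupGenerator U)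
    (hacc : IsAccretive (semigroupGenerator T))
    (hdense : Dense ((semigroupGenerator T).domain : Set H)) : T = U := by
  funext t
  refine ContinuousLinearMap.ext fun u => ?_
  exact hdense.induction (P := fun u => T t u = U t u)
    (fun u ⟨v, hv⟩ => hT.apply_eq_of_hasGeneratorValue hU hTU hacc hv t)
    (isClosed_eq (T t).continuous (U t).continuous) u

end IsC0Semigroup

/-- Polarisation: apply the sector bound to x + y and x - y. Subtracting the imaginary parts
isolates the cross terms, while adding the real parts cancels them. -/
theorem abs_im_inner_add_im_inner_le {S : H →ₗ.[ℂ] H} {k : ℝ}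
    (hS : ∀ u v, (u, v) ∈ S.graph → |(inner ℂ u v).im| ≤ k * (inner ℂ u v).re) {x x' y y' : H}
    (hx : (x, x') ∈ S.graph) (hy : (y, y') ∈ S.graph) :
    |(inner ℂ x y').im + (inner ℂ y x').im| ≤ k * ((inner ℂ x x').re + (inner ℂ y y').re) := by
  have h1 := hS _ _ (Submodule.add_mem _ hx hy)
  have h2 := hS _ _ (Submodule.sub_mem _ hx hy)
  simp only [inner_add_left, inner_add_right, inner_sub_left, inner_sub_right, Complex.add_re,
    Complex.sub_re, Complex.add_im, Complex.sub_im] at h1 h2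
  rw [abs_le] at *
  constructor <;> linarith [h1.1, h1.2, h2.1, h2.2]

namespace IsC0Semigroup

variable {T : ℝ≥0 → H →L[ℂ] H} {u v : H} [CompleteSpace H]

/-- Reversing time in one factor makes the derivative of the inner product a sum of cross terms,
exactly what the polarised sector bound controls; the norm terms supply the compensating real parts.
-/
theorem two_mul_abs_im_inner_le (hT : IsC0Semigroup T) {k : ℝ}
    (hS : ∀ u v, HasGeneratorValue T u v → |(inner ℂ u v).im| ≤ k * (inner ℂ u v).re)
    (h : HasGeneratorValue T u v) (t : ℝ≥0) :
    2 * |(inner ℂ u (T t u)).im| ≤ k * (‖u‖ ^ 2 - ‖T t u‖ ^ 2) := by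
  set x : ℝ → H := fun s => T s.toNNReal u with hx
  set x' : ℝ → H := fun s => T s.toNNReal v with hx'
  have hxc : Continuous x := hT.continuous_orbit u
  have hyc : Continuous fun s => x (t - s) := hxc.comp (continuous_const.sub continuous_id)
  have hd : ∀ s ∈ Set.Ioo (0 : ℝ) t, HasDerivAt x (-x' s) s := fun s hs =>
    hT.hasDerivAt_orbit h hs.1
  have hdy : ∀ s ∈ Set.Ioo (0 : ℝ) t, HasDerivAt (fun s => x (t - s)) (x' (t - s)) s := by
    intro s hs
    have := HasDerivAt.scomp s (hT.hasDerivAt_orbit h (sub_pos.2 hs.2))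
      ((hasDerivAt_id s).const_sub (t : ℝ))
    rw [neg_one_smul, neg_neg] at this
    exact this
  have hgen : ∀ s : ℝ, (x s, x' s) ∈ (semigroupGenerator T).graph := fun s =>
    mem_graph_semigroupGenerator_iff.2 (hT.hasGeneratorValue_apply h s.toNNReal)
  have hx0 : x 0 = u := by simp [hx, hT.map_zero]
  have hxt : x t = T t u := by simp [hx]
  have main : ∀ σ : ℝ, |σ| = 1 →
      σ * (2 * (inner ℂ u (T t u)).im) ≤ k * (‖u‖ ^ 2 - ‖T t u‖ ^ 2) := by
    intro σ hσ
    have hder : ∀ s ∈ Set.Ioo (0 : ℝ) t, HasDerivAt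
        (fun s => σ * (inner ℂ (x (t - s)) (x s)).im + k / 2 * (‖x s‖ ^ 2 - ‖x (t - s)‖ ^ 2))
        (σ * ((inner ℂ (x (t - s)) (-x' s)).im + (inner ℂ (x' (t - s)) (x s)).im) +
          k / 2 * (2 * (inner ℂ (x s) (-x' s)).re - 2 * (inner ℂ (x (t - s)) (x' (t - s))).re))
        s := fun s hs => (((hdy s hs).inner_im (hd s hs)).const_mul σ).add
          (((hd s hs).complex_norm_sq.sub (hdy s hs).complex_norm_sq).const_mul (k / 2))
    have hanti : AntitoneOn
        (fun s => σ * (inner ℂ (x (t - s)) (x s)).im + k / 2 * (‖x s‖ ^ 2 - ‖x (t - s)‖ ^ 2))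
        (Set.Icc 0 t) := by
      refine antitoneOn_of_deriv_nonpos (convex_Icc _ _) ?_ ?_ ?_
      · exact (((Complex.continuous_im.comp (hyc.inner hxc)).const_mul σ).add
          (((hxc.norm.pow 2).sub (hyc.norm.pow 2)).const_mul (k / 2))).continuousOn
      · rw [interior_Icc]
        exact fun s hs => (hder s hs).differentiableAt.differentiableWithinAt
      · rw [interior_Icc]
        intro s hs
        rw [(hder s hs).deriv]
        have hb := abs_im_inner_add_im_inner_le
          (fun u v huv => hS u v (mem_graph_semigroupGenerator_iff.1 huv))
          (hgen s) (hgen (t - s))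
        have hb' := neg_abs_le (σ * ((inner ℂ (x s) (x' (t - s))).im +
          (inner ℂ (x (t - s)) (x' s)).im))
        rw [abs_mul, hσ, one_mul] at hb'
        rw [inner_neg_right, inner_neg_right, Complex.neg_im, Complex.neg_re,
          ← inner_conj_symm (x' (t - s)) (x s), Complex.conj_im]
        linarith
    -- The two end values are opposite to each other, which produces the factor 2.
    have hle := hanti (Set.left_mem_Icc.2 t.coe_nonneg) (Set.right_mem_Icc.2 t.coe_nonneg)
      t.coe_nonneg
    simp only [sub_self, sub_zero, hx0, hxt] at hle
    rw [← inner_conj_symm (T t u) u, Complex.conj_im] at hle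
    linarith
  rcases abs_cases (inner ℂ u (T t u)).im with ⟨h, -⟩ | ⟨h, -⟩ <;> rw [h]
  · simpa using main 1 (by simp)
  · simpa using main (-1) (by simp)

theorem mem_classC (hT : IsC0Semigroup T) {α : ℝ} (hα₀ : 0 ≤ α) (hα₁ : α < Real.pi / 2)
    (hS : IsMSectorial α (semigroupGenerator T)) (t : ℝ≥0) : T t ∈ classC α := by
  have hacc := hS.mAccretive.accretive
  have hdense := hS.mAccretive.dense_domain
  rw [mem_classC_iff hα₀ hα₁ (hT.norm_le_one_of_isAccretive hacc hdense t)]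
  have hsec := (hacc.numRange_subset_closedSector_iff hα₀ hα₁).1 hS.numRange_subset
  have hsec' : ∀ u v, HasGeneratorValue T u v →
      |(inner ℂ u v).im| ≤ Real.tan α * (inner ℂ u v).re := by
    intro u v huv
    obtain ⟨y, rfl, rfl⟩ := (LinearPMap.mem_graph_iff _).1 (mem_graph_semigroupGenerator_iff.2 huv)
    exact hsec y
  have hc := (T t).continuous
  refine fun u => hdense.induction
    (P := fun u => 2 * |(inner ℂ u (T t u)).im| ≤ Real.tan α * (‖u‖ ^ 2 - ‖T t u‖ ^ 2))
    (fun u ⟨v, hv⟩ => hT.two_mul_abs_im_inner_le hsec' hv t) (isClosed_le ?_ ?_) u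
  · exact (Complex.continuous_im.comp (continuous_id.inner hc)).abs.const_mul 2
  · exact ((continuous_norm.pow 2).sub (hc.norm.pow 2)).const_mul _

end IsC0Semigroup

end Semigroup

/-! ### Accretivity and the sector bound for differences u - Lu. -/

section AccretiveGenerator

variable {H : Type*} [NormedAddCommGroup H] [InnerProductSpace ℂ H]

theorem re_inner_sub_apply_nonneg {L : H →L[ℂ] H} {u : H} (hL : ‖L u‖ ≤ ‖u‖) :
    0 ≤ (inner ℂ u (u - L u)).re := by
  have h := (Complex.re_le_norm _).trans (norm_inner_le_norm (𝕜 := ℂ) u (L u))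
  have h2 := mul_le_mul_of_nonneg_left hL (norm_nonneg u)
  rw [inner_sub_right, Complex.sub_re, ← RCLike.re_to_complex, ← norm_sq_eq_re_inner]
  nlinarith

theorem HasGeneratorValue.tendsto_inner {T : ℝ≥0 → H →L[ℂ] H} {u v : H}
    (h : HasGeneratorValue T u v) (w : H) :
    Tendsto (fun t : ℝ≥0 => ((t : ℝ)⁻¹ : ℝ) • inner ℂ w (u - T t u)) (𝓝[>] 0)
      (𝓝 (inner ℂ w v)) :=
  (Tendsto.inner tendsto_const_nhds h).congr fun _ => inner_smul_right_eq_smul _ _ _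

theorem isAccretive_semigroupGenerator {T : ℝ≥0 → H →L[ℂ] H} (hT : ∀ t u, ‖T t u‖ ≤ ‖u‖) :
    IsAccretive (semigroupGenerator T) := by
  intro u
  have h := (hasGeneratorValue_semigroupGenerator T u).tendsto_inner u
  refine ge_of_tendsto' ((Complex.continuous_re.tendsto _).comp h) fun t => ?_
  rw [Function.comp_apply, Complex.smul_re]
  exact mul_nonneg (inv_nonneg.2 t.coe_nonneg) (re_inner_sub_apply_nonneg (hT t u))

theorem abs_im_inner_sub_apply_le {L : H →L[ℂ] H} {k : ℝ} (hk : 0 ≤ k) {u : H}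
    (h : 2 * |(inner ℂ u (L u)).im| ≤ k * (‖u‖ ^ 2 - ‖L u‖ ^ 2)) :
    |(inner ℂ u (u - L u)).im| ≤ k * (inner ℂ u (u - L u)).re := by
  have him : (inner ℂ u (u - L u)).im = -(inner ℂ u (L u)).im := by
    rw [inner_sub_right, inner_self_eq_norm_sq_to_K]
    simp [← Complex.ofReal_pow]
  have hre : ‖L u‖ ^ 2 = ‖u‖ ^ 2 - 2 * (inner ℂ u (u - L u)).re + ‖u - L u‖ ^ 2 := by
    have := @norm_sub_sq ℂ _ _ _ _ u (u - L u)
    rwa [sub_sub_cancel] at this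
  rw [him, abs_neg]
  have := mul_nonneg hk (sq_nonneg ‖u - L u‖)
  rw [hre] at h
  linarith

end AccretiveGenerator

/-! ### Resolvents and Yosida approximations of m-accretive operators. -/

section Resolvent

variable {H : Type*} [NormedAddCommGroup H] [InnerProductSpace ℂ H]

theorem IsAccretive.norm_add_smul_ge {S : H →ₗ.[ℂ] H} (hS : IsAccretive S) {r : ℝ} (hr : 0 ≤ r)
    {u v : H} (h : (u, v) ∈ S.graph) : ‖u‖ ≤ ‖u + (r : ℂ) • v‖ := by
  have h0 := hS.re_inner_nonneg h
  refine (sq_le_sq₀ (norm_nonneg _) (norm_nonneg _)).1 ?_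
  rw [@norm_add_sq ℂ, inner_smul_right, RCLike.re_to_complex, Complex.re_ofReal_mul]
  have := mul_nonneg hr h0
  nlinarith [sq_nonneg ‖(r : ℂ) • v‖]

theorem IsAccretive.eq_of_add_smul_eq {S : H →ₗ.[ℂ] H} (hS : IsAccretive S) {r : ℝ} (hr : 0 ≤ r)
    {u v u' v' : H} (h : (u, v) ∈ S.graph) (h' : (u', v') ∈ S.graph)
    (heq : u + (r : ℂ) • v = u' + (r : ℂ) • v') : u = u' := by
  have := hS.norm_add_smul_ge hr (Submodule.sub_mem _ h h')
  rw [smul_sub, sub_add_sub_comm, heq, sub_self, norm_zero] at this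
  exact sub_eq_zero.1 (norm_le_zero_iff.1 this)

/-- I + rS is bounded below on the complete graph of S, so its range is closed; accretivity of the
adjoint makes the range dense. -/
theorem IsMAccretive.exists_add_smul_eq [CompleteSpace H] {S : H →ₗ.[ℂ] H} (hS : IsMAccretive S)
    {r : ℝ} (hr : 0 < r) (f : H) : ∃ u v, (u, v) ∈ S.graph ∧ u + (r : ℂ) • v = f := by
  let Φ : H × H →L[ℂ] H := ContinuousLinearMap.fst ℂ H H + (r : ℂ) • ContinuousLinearMap.snd ℂ H H
  have hΦ : ∀ p : H × H, Φ p = p.1 + (r : ℂ) • p.2 := fun p => rfl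
  let Ψ : S.graph →L[ℂ] H := Φ.comp S.graph.subtypeL
  have hcomplete : CompleteSpace S.graph := hS.closed.completeSpace_coe
  -- With f = u + rv, accretivity gives ‖u‖ ≤ ‖f‖, hence r‖v‖ ≤ 2‖f‖.
  have hbound : ∀ p : S.graph, ‖p‖ ≤ (1 + 2 * r⁻¹) * ‖Ψ p‖ := by
    rintro ⟨⟨u, v⟩, h⟩
    have h1 : ‖u‖ ≤ ‖u + (r : ℂ) • v‖ := hS.accretive.norm_add_smul_ge hr.le h
    have h2 : ‖v‖ ≤ 2 * r⁻¹ * ‖u + (r : ℂ) • v‖ := by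
      have h3 : ‖(r : ℂ) • v‖ ≤ 2 * ‖u + (r : ℂ) • v‖ := by
        have := norm_sub_le (u + (r : ℂ) • v) u
        rw [add_sub_cancel_left] at this
        linarith
      rw [norm_smul, Complex.norm_real, Real.norm_of_nonneg hr.le] at h3
      rw [mul_comm 2, mul_assoc, le_inv_mul_iff₀ hr]
      exact h3
    have h4 : 0 ≤ 2 * r⁻¹ * ‖u + (r : ℂ) • v‖ := by positivity
    change max ‖u‖ ‖v‖ ≤ (1 + 2 * r⁻¹) * ‖u + (r : ℂ) • v‖
    rw [add_mul, one_mul]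
    exact max_le (by linarith) (by linarith [norm_nonneg (u + (r : ℂ) • v)])
  have hanti : AntilipschitzWith (1 + 2 * r⁻¹).toNNReal Ψ := by
    refine AddMonoidHomClass.antilipschitz_of_bound Ψ fun p => ?_
    rw [Real.coe_toNNReal _ (by positivity)]
    exact hbound p
  have hclosed : IsClosed (LinearMap.range Ψ.toLinearMap : Set H) := by
    rw [LinearMap.coe_range]
    exact hanti.isClosed_range Ψ.uniformContinuous
  have : CompleteSpace (LinearMap.range Ψ.toLinearMap) := hclosed.completeSpace_coe
  have htop : LinearMap.range Ψ.toLinearMap = ⊤ := by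
    rw [← Submodule.orthogonal_eq_bot_iff, eq_bot_iff]
    -- A vector w orthogonal to the range satisfies S*w = -r⁻¹w, so accretivity of S* forces w = 0.
    intro w hw
    have horth : ∀ x : S.domain, inner ℂ w ((x : H) + (r : ℂ) • S x) = 0 := fun x =>
      Submodule.inner_left_of_mem_orthogonal (LinearMap.mem_range.2 ⟨⟨_, S.mem_graph x⟩, rfl⟩) hw
    have hrc : (r : ℂ) ≠ 0 := Complex.ofReal_ne_zero.2 hr.ne'
    have hadj : ∀ x : S.domain, inner ℂ (-((r⁻¹ : ℝ) : ℂ) • w) (x : H) = inner ℂ w (S x) := by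
      intro x
      have := horth x
      rw [inner_add_right, inner_smul_right] at this
      rw [inner_smul_left, map_neg, Complex.conj_ofReal, Complex.ofReal_inv,
        eq_neg_of_add_eq_zero_left this]
      field_simp
    have hwmem : w ∈ S.adjoint.domain := LinearPMap.mem_adjoint_domain_of_exists _ ⟨_, hadj⟩
    have hval := LinearPMap.adjoint_apply_eq hS.dense_domain ⟨w, hwmem⟩ hadj
    have hacc := hS.adjoint_accretive ⟨w, hwmem⟩
    rw [hval, inner_smul_right, ← Complex.ofReal_neg, Complex.re_ofReal_mul,
      ← RCLike.re_to_complex, ← norm_sq_eq_re_inner] at hacc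
    have : r⁻¹ * ‖w‖ ^ 2 ≤ 0 := by simpa using hacc
    have : ‖w‖ ^ 2 = 0 := le_antisymm (nonpos_of_mul_nonpos_right this (inv_pos.2 hr)) (sq_nonneg _)
    simpa using this
  obtain ⟨⟨⟨u, v⟩, h⟩, rfl⟩ := LinearMap.mem_range.1 (htop ▸ Submodule.mem_top : f ∈ _)
  exact ⟨u, v, h, rfl⟩

/-- The resolvent `(I + rS)⁻¹` of `S` at the parameter `r > 0`, characterised through the Yosida
approximation `r⁻¹ (I - J)`. -/
structure IsResolvent (S : H →ₗ.[ℂ] H) (r : ℝ) (J : H →L[ℂ] H) : Prop where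
  pos : 0 < r
  mem_graph : ∀ f, (J f, ((r⁻¹ : ℝ) : ℂ) • (f - J f)) ∈ S.graph

theorem IsMAccretive.exists_isResolvent [CompleteSpace H] {S : H →ₗ.[ℂ] H} (hS : IsMAccretive S)
    {r : ℝ} (hr : 0 < r) : ∃ J : H →L[ℂ] H, IsResolvent S r J := by
  choose J A hJ hJA using hS.exists_add_smul_eq hr
  have hrc : (r : ℂ) ≠ 0 := Complex.ofReal_ne_zero.2 hr.ne'
  have huniq : ∀ {u v f : H}, (u, v) ∈ S.graph → u + (r : ℂ) • v = f → J f = u :=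
    fun h hf => hS.accretive.eq_of_add_smul_eq hr.le (hJ _) h ((hJA _).trans hf.symm)
  let L : H →ₗ[ℂ] H :=
    { toFun := J
      map_add' := fun f g => huniq (Submodule.add_mem _ (hJ f) (hJ g)) (by
        conv_rhs => rw [← hJA f, ← hJA g]
        rw [smul_add]
        abel)
      map_smul' := fun c f => huniq (Submodule.smul_mem _ c (hJ f)) (by
        conv_rhs => rw [← hJA f]
        rw [smul_add, smul_comm c]
        rfl) }
  refine ⟨L.mkContinuous 1 fun f => ?_, hr, fun f => ?_⟩
  · rw [one_mul]
    change ‖J f‖ ≤ ‖f‖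
    conv_rhs => rw [← hJA f]
    exact hS.accretive.norm_add_smul_ge hr.le (hJ f)
  · change (J f, ((r⁻¹ : ℝ) : ℂ) • (f - J f)) ∈ S.graph
    have : A f = ((r⁻¹ : ℝ) : ℂ) • (f - J f) := by
      rw [Complex.ofReal_inv, eq_inv_smul_iff₀ hrc, eq_sub_iff_add_eq', hJA f]
    exact this ▸ hJ f

/-- The Yosida approximation `r⁻¹ (I - J)`. -/
noncomputable def yosidaApprox (r : ℝ) (J : H →L[ℂ] H) : H →L[ℂ] H :=
  ((r⁻¹ : ℝ) : ℂ) • (1 - J)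

namespace IsResolvent

variable {S : H →ₗ.[ℂ] H} {r r' : ℝ} {J J' : H →L[ℂ] H} {u v : H}

theorem mem_graph_yosidaApprox (hJ : IsResolvent S r J) (f : H) :
    (J f, yosidaApprox r J f) ∈ S.graph := hJ.mem_graph f

theorem add_smul_yosidaApprox (hJ : IsResolvent S r J) (f : H) :
    J f + (r : ℂ) • yosidaApprox r J f = f := by
  have hrc : (r : ℂ) ≠ 0 := Complex.ofReal_ne_zero.2 hJ.pos.ne'
  change J f + (r : ℂ) • ((r⁻¹ : ℝ) : ℂ) • (f - J f) = f
  rw [Complex.ofReal_inv, smul_inv_smul₀ hrc, add_sub_cancel]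

theorem norm_apply_le (hJ : IsResolvent S r J) (hS : IsAccretive S) (f : H) : ‖J f‖ ≤ ‖f‖ := by
  conv_rhs => rw [← hJ.add_smul_yosidaApprox f]
  exact hS.norm_add_smul_ge hJ.pos.le (hJ.mem_graph_yosidaApprox f)

theorem re_inner_yosidaApprox_nonneg (hJ : IsResolvent S r J) (hS : IsAccretive S) (f : H) :
    0 ≤ (inner ℂ f (yosidaApprox r J f)).re := by
  have h := hS.re_inner_nonneg (hJ.mem_graph_yosidaApprox f)
  nth_rw 1 [← hJ.add_smul_yosidaApprox f]
  rw [inner_add_left, inner_smul_left, Complex.conj_ofReal, Complex.add_re, Complex.re_ofReal_mul,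
    ← RCLike.re_to_complex (x := inner ℂ (yosidaApprox r J f) _), ← norm_sq_eq_re_inner]
  have := mul_nonneg hJ.pos.le (sq_nonneg ‖yosidaApprox r J f‖)
  linarith

theorem apply_eq (hJ : IsResolvent S r J) (hS : IsAccretive S) {f : H} (h : (u, v) ∈ S.graph)
    (hf : u + (r : ℂ) • v = f) : J f = u :=
  hS.eq_of_add_smul_eq hJ.pos.le (hJ.mem_graph_yosidaApprox f) h
    ((hJ.add_smul_yosidaApprox f).trans hf.symm)

theorem apply_add_smul (hJ : IsResolvent S r J) (hS : IsAccretive S) (h : (u, v) ∈ S.graph) :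
    J u + (r : ℂ) • J v = u := by
  rw [← map_smul, ← map_add]
  exact hJ.apply_eq hS h rfl

theorem yosidaApprox_apply (hJ : IsResolvent S r J) (hS : IsAccretive S) (h : (u, v) ∈ S.graph) :
    yosidaApprox r J u = J v := by
  have hrc : (r : ℂ) ≠ 0 := Complex.ofReal_ne_zero.2 hJ.pos.ne'
  refine smul_right_injective H hrc (add_left_cancel (a := J u) ?_)
  exact (hJ.add_smul_yosidaApprox u).trans (hJ.apply_add_smul hS h).symm

/-- S J f lies in the range of the bounded operator `yosidaApprox r J`, and J' intertwines with S on
dom S; uniqueness of the solution of (I + rS)u = J'f then identifies both products. -/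
theorem commute (hJ : IsResolvent S r J) (hJ' : IsResolvent S r' J') (hS : IsAccretive S) :
    Commute J J' := by
  refine ContinuousLinearMap.ext fun f => ?_
  change J (J' f) = J' (J f)
  have hg := hJ.mem_graph_yosidaApprox f
  refine hJ.apply_eq hS (hJ'.mem_graph_yosidaApprox (J f)) ?_
  rw [hJ'.yosidaApprox_apply hS hg, ← map_smul, ← map_add, hJ.add_smul_yosidaApprox]

theorem commute_yosidaApprox (hJ : IsResolvent S r J) (hJ' : IsResolvent S r' J')
    (hS : IsAccretive S) : Commute (yosidaApprox r J) (yosidaApprox r' J') :=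
  ((((Commute.one_left _).sub_left ((Commute.one_right _).sub_right
    (hJ.commute hJ' hS)))).smul_left _).smul_right _

end IsResolvent

/-- Resolvents with parameters tending to `0` converge strongly to the identity. -/
theorem tendsto_resolvent_apply {S : H →ₗ.[ℂ] H} (hS : IsAccretive S)
    (hdense : Dense (S.domain : Set H)) {r : ℕ → ℝ} {J : ℕ → H →L[ℂ] H}
    (hJ : ∀ n, IsResolvent S (r n) (J n)) (hr : Tendsto r atTop (𝓝 0)) (f : H) :
    Tendsto (fun n => J n f) atTop (𝓝 f) := by
  rw [Metric.tendsto_atTop]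
  intro ε hε
  obtain ⟨u, hu, hfu⟩ := hdense.exists_dist_lt f (by positivity : 0 < ε / 3)
  obtain ⟨v, huv⟩ := LinearPMap.mem_domain_iff.1 hu
  have hrv : Tendsto (fun n => r n * ‖v‖) atTop (𝓝 0) := by simpa using hr.mul_const ‖v‖
  obtain ⟨N, hN⟩ := eventually_atTop.1 (hrv.eventually_lt_const (by positivity : 0 < ε / 3))
  refine ⟨N, fun n hn => ?_⟩
  have h1 : dist (J n f) (J n u) < ε / 3 := by
    rw [dist_eq_norm, ← map_sub]
    exact ((hJ n).norm_apply_le hS _).trans_lt (by rwa [← dist_eq_norm])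
  have h2 : dist (J n u) u < ε / 3 := by
    refine lt_of_le_of_lt ?_ (hN n hn)
    have := (hJ n).apply_add_smul hS huv
    nth_rw 2 [← this]
    rw [dist_eq_norm, sub_add_cancel_left, norm_neg, norm_smul, Complex.norm_real,
      Real.norm_of_nonneg (hJ n).pos.le]
    exact mul_le_mul_of_nonneg_left ((hJ n).norm_apply_le hS v) (hJ n).pos.le
  have := dist_triangle4 (J n f) (J n u) u f
  rw [dist_comm u f] at this
  linarith

end Resolvent

/-! ### Exponentials of bounded accretive operators. -/

section Exponential

open NormedSpace (exp)

variable {H : Type*} [NormedAddCommGroup H] [InnerProductSpace ℂ H] [CompleteSpace H]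
  {A B : H →L[ℂ] H}

theorem hasDerivAt_exp_smul_apply (A : H →L[ℂ] H) (u : H) (t : ℝ) :
    HasDerivAt (fun s : ℝ => exp (s • A) u) (exp (t • A) (A u)) t := by
  exact ((ContinuousLinearMap.apply ℂ H u).restrictScalars ℝ).hasFDerivAt.comp_hasDerivAt t
    (hasDerivAt_exp_smul_const (𝕂 := ℝ) A t)

theorem norm_exp_neg_apply_le (hA : ∀ u, 0 ≤ (inner ℂ u (A u)).re) (u : H) :
    ‖exp (-A) u‖ ≤ ‖u‖ := by
  have hd := fun t : ℝ => hasDerivAt_exp_smul_apply (-A) u t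
  have hcomm : ∀ t : ℝ, exp (t • (-A)) ((-A) u) = -A (exp (t • (-A)) u) := by
    intro t
    have : Commute (exp (t • (-A))) (-A) := ((Commute.refl (-A)).smul_left t).exp_left
    exact congrArg (fun L : H →L[ℂ] H => L u) this.eq
  have := norm_le_of_re_inner_deriv_nonpos zero_le_one
    (fun t _ => (hd t).continuousAt.continuousWithinAt) (fun t _ => hd t) (fun t _ => by
      rw [hcomm, inner_neg_right, Complex.neg_re]
      linarith [hA (exp (t • (-A)) u)])
  simpa using this

/-- Interpolate by exp(-((1 - t)A + tB))u. Commutativity makes its derivative this exponential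
applied to (A - B)u, and a convex combination of accretive operators is accretive, so the
exponential is a contraction. -/
theorem norm_exp_neg_sub_exp_neg_le (hA : ∀ u, 0 ≤ (inner ℂ u (A u)).re)
    (hB : ∀ u, 0 ≤ (inner ℂ u (B u)).re) (hAB : Commute A B) (u : H) :
    ‖exp (-A) u - exp (-B) u‖ ≤ ‖A u - B u‖ := by
  let _ : NormedAlgebra ℚ (H →L[ℂ] H) := NormedAlgebra.restrictScalars ℚ ℂ (H →L[ℂ] H)
  have hc : ∀ t : ℝ, Commute (-A) (t • (A - B)) := fun t =>
    (((Commute.refl A).sub_right hAB).neg_left).smul_right t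
  have hd : ∀ t : ℝ, HasDerivAt (fun s : ℝ => exp (-A) (exp (s • (A - B)) u))
      (exp (-A) (exp (t • (A - B)) ((A - B) u))) t := fun t =>
    ((exp (-A)).restrictScalars ℝ).hasFDerivAt.comp_hasDerivAt t
      (hasDerivAt_exp_smul_apply (A - B) u t)
  have hbound : ∀ t ∈ Set.Ico (0 : ℝ) 1,
      ‖exp (-A) (exp (t • (A - B)) ((A - B) u))‖ ≤ ‖A u - B u‖ := by
    intro t ht
    rw [← mul_apply_eq_comp, ← NormedSpace.exp_add_of_commute (hc t)]
    have : -A + t • (A - B) = -((1 - t) • A + t • B) := by module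
    rw [this]
    refine norm_exp_neg_apply_le (fun w => ?_) _
    have h1 := mul_nonneg (sub_nonneg.2 ht.2.le) (hA w)
    have h2 := mul_nonneg ht.1 (hB w)
    have h3 : (inner ℂ w (((1 - t) • A + t • B) w)).re =
        (1 - t) * (inner ℂ w (A w)).re + t * (inner ℂ w (B w)).re := by
      rw [_root_.add_apply, _root_.smul_apply, _root_.smul_apply, inner_add_right, inner_smul_right_eq_smul,
        inner_smul_right_eq_smul, Complex.add_re, Complex.smul_re, Complex.smul_re]
      rfl
    rw [h3]
    linarith
  have := norm_image_sub_le_of_norm_deriv_le_segment_01'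
    (fun t _ => (hd t).hasDerivWithinAt) hbound
  have hone : exp (-A) (exp ((1 : ℝ) • (A - B)) u) = exp (-B) u := by
    rw [← mul_apply_eq_comp, ← NormedSpace.exp_add_of_commute (hc 1), one_smul,
      neg_add_eq_sub, sub_sub_cancel_left]
  rwa [hone, zero_smul, NormedSpace.exp_zero, one_apply_eq_self, norm_sub_rev] at this

end Exponential

/-! ### Existence of the semigroup generated by an m-accretive operator. -/

section Generation

open NormedSpace (exp)

variable {H : Type*} [NormedAddCommGroup H] [InnerProductSpace ℂ H]

theorem cauchySeq_apply_of_dense {L : ℕ → H →L[ℂ] H} (hL : ∀ n u, ‖L n u‖ ≤ ‖u‖) {D : Set H}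
    (hD : Dense D) (h : ∀ u ∈ D, CauchySeq fun n => L n u) (f : H) :
    CauchySeq fun n => L n f := by
  rw [Metric.cauchySeq_iff]
  intro ε hε
  obtain ⟨u, hu, hfu⟩ := hD.exists_dist_lt f (by positivity : 0 < ε / 3)
  obtain ⟨N, hN⟩ := Metric.cauchySeq_iff.1 (h u hu) (ε / 3) (by positivity)
  have hclose : ∀ n, dist (L n f) (L n u) < ε / 3 := fun n => by
    rw [dist_eq_norm, ← map_sub]
    exact (hL n _).trans_lt (by rwa [← dist_eq_norm])
  refine ⟨N, fun m hm n hn => ?_⟩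
  have := dist_triangle4 (L m f) (L m u) (L n u) (L n f)
  have h1 := hclose m
  have h2 := hclose n
  have h3 := hN m hm n hn
  rw [dist_comm (L n f)] at h2
  linarith

theorem continuous_apply_of_dense {X : Type*} [TopologicalSpace X] {L : X → H →L[ℂ] H}
    (hL : ∀ x u, ‖L x u‖ ≤ ‖u‖) {D : Set H} (hD : Dense D)
    (h : ∀ u ∈ D, Continuous fun x => L x u) (f : H) : Continuous fun x => L x f := by
  refine continuous_of_uniform_approx_of_continuous fun s hs => ?_
  obtain ⟨ε, hε, hεs⟩ := Metric.mem_uniformity_dist.1 hs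
  obtain ⟨u, hu, hfu⟩ := hD.exists_dist_lt f hε
  refine ⟨fun x => L x u, h u hu, fun x => hεs ?_⟩
  rw [dist_eq_norm, ← map_sub]
  exact (hL x _).trans_lt (by rwa [← dist_eq_norm])

variable [CompleteSpace H]

/-- Equal times give convergence of the approximating semigroups; equal operators give Lipschitz
continuity in time. -/
theorem norm_exp_neg_smul_sub_exp_neg_smul_le {A B : H →L[ℂ] H}
    (hA : ∀ u, 0 ≤ (inner ℂ u (A u)).re) (hB : ∀ u, 0 ≤ (inner ℂ u (B u)).re)
    (hAB : Commute A B) (s t : ℝ≥0) (u : H) :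
    ‖exp (-((s : ℝ) • A)) u - exp (-((t : ℝ) • B)) u‖ ≤ ‖(s : ℝ) • A u - (t : ℝ) • B u‖ := by
  have hsmul : ∀ {C : H →L[ℂ] H} (r : ℝ≥0), (∀ u, 0 ≤ (inner ℂ u (C u)).re) →
      ∀ u, 0 ≤ (inner ℂ u (((r : ℝ) • C) u)).re := by
    intro C r hC u
    rw [_root_.smul_apply, inner_smul_right_eq_smul, Complex.smul_re]
    exact mul_nonneg r.coe_nonneg (hC u)
  exact norm_exp_neg_sub_exp_neg_le (hsmul s hA) (hsmul t hB) ((hAB.smul_left _).smul_right _) u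

theorem IsMAccretive.exists_isC0Semigroup {S : H →ₗ.[ℂ] H} (hS : IsMAccretive S) :
    ∃ T : ℝ≥0 → H →L[ℂ] H, IsC0Semigroup T ∧ semigroupGenerator T = S := by
  have hacc := hS.accretive
  have hrpos : ∀ n : ℕ, (0 : ℝ) < 1 / ((n : ℝ) + 1) := fun n => Nat.one_div_pos_of_nat
  choose J hJ using fun n : ℕ => hS.exists_isResolvent (hrpos n)
  set A : ℕ → H →L[ℂ] H := fun n => yosidaApprox (1 / ((n : ℝ) + 1)) (J n) with hA
  have hAacc : ∀ n u, 0 ≤ (inner ℂ u (A n u)).re := fun n =>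
    (hJ n).re_inner_yosidaApprox_nonneg hacc
  have hAcomm : ∀ m n, Commute (A m) (A n) := fun m n => (hJ m).commute_yosidaApprox (hJ n) hacc
  have hJlim := tendsto_resolvent_apply hacc hS.dense_domain hJ tendsto_one_div_add_atTop_nhds_zero_nat
  have hAval : ∀ {u v}, (u, v) ∈ S.graph → ∀ n, A n u = J n v := fun h n =>
    (hJ n).yosidaApprox_apply hacc h
  set E : ℕ → ℝ≥0 → H →L[ℂ] H := fun n t => exp (-((t : ℝ) • A n)) with hE
  have hE_sub : ∀ m n s t u, ‖E m s u - E n t u‖ ≤ ‖(s : ℝ) • A m u - (t : ℝ) • A n u‖ :=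
    fun m n s t u =>
      norm_exp_neg_smul_sub_exp_neg_smul_le (hAacc m) (hAacc n) (hAcomm m n) s t u
  have hE_zero : ∀ n, E n 0 = 1 := fun n => by simp [hE, NormedSpace.exp_zero]
  have hE_norm : ∀ n t u, ‖E n t u‖ ≤ ‖u‖ := fun n t u => by
    refine norm_exp_neg_apply_le (fun w => ?_) u
    rw [_root_.smul_apply, inner_smul_right_eq_smul, Complex.smul_re]
    exact mul_nonneg t.coe_nonneg (hAacc n w)
  have hE_add : ∀ n s t u, E n (s + t) u = E n s (E n t u) := fun n s t u => by
    let _ : NormedAlgebra ℚ (H →L[ℂ] H) := NormedAlgebra.restrictScalars ℚ ℂ (H →L[ℂ] H)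
    rw [← mul_apply_eq_comp, hE]
    dsimp only
    rw [← NormedSpace.exp_add_of_commute, NNReal.coe_add, add_smul, neg_add]
    exact (((Commute.refl (A n)).smul_left _).smul_right _).neg_left.neg_right
  have hcauchy : ∀ (t : ℝ≥0) u, CauchySeq fun n => E n t u := by
    intro t u
    refine cauchySeq_apply_of_dense (fun n => hE_norm n t) hS.dense_domain (fun u hu => ?_) u
    obtain ⟨v, huv⟩ := LinearPMap.mem_domain_iff.1 hu
    have h1 := cauchySeq_iff_tendsto_dist_atTop_0.1 ((hJlim v).const_smul (t : ℝ)).cauchySeq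
    refine cauchySeq_iff_tendsto_dist_atTop_0.2
      (squeeze_zero (fun _ => dist_nonneg) (fun p => ?_) h1)
    rw [dist_eq_norm, dist_eq_norm, ← hAval huv, ← hAval huv]
    exact hE_sub _ _ _ _ _
  choose T₀ hT₀ using fun t u => cauchySeq_tendsto_of_complete (hcauchy t u)
  let T : ℝ≥0 → H →L[ℂ] H := fun t =>
    continuousLinearMapOfTendsto (fun n => E n t) (tendsto_pi_nhds.2 (hT₀ t))
  have hT : ∀ t u, Tendsto (fun n => E n t u) atTop (𝓝 (T t u)) := hT₀
  have hT_norm : ∀ t u, ‖T t u‖ ≤ ‖u‖ := fun t u =>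
    le_of_tendsto (hT t u).norm (Eventually.of_forall fun n => hE_norm n t u)
  have hsemi : IsC0Semigroup T := by
    refine ⟨?_, fun s t => ?_, fun u => ?_⟩
    · refine ContinuousLinearMap.ext fun u => tendsto_nhds_unique (hT 0 u) ?_
      simp [hE_zero]
    · refine ContinuousLinearMap.ext fun u => tendsto_nhds_unique (hT (s + t) u) ?_
      have h1 : Tendsto (fun n => E n s (E n t u) - E n s (T t u)) atTop (𝓝 0) := by
        refine squeeze_zero_norm (fun n => ?_) (tendsto_iff_norm_sub_tendsto_zero.1 (hT t u))
        rw [← map_sub]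
        exact hE_norm n s _
      have h2 := h1.add (hT s (T t u))
      rw [zero_add] at h2
      refine h2.congr fun n => ?_
      rw [sub_add_cancel, hE_add]
    · refine continuous_apply_of_dense hT_norm hS.dense_domain (fun u hu => ?_) u
      obtain ⟨v, huv⟩ := LinearPMap.mem_domain_iff.1 hu
      have hlip : LipschitzWith ‖v‖₊ fun t => T t u := by
        refine LipschitzWith.of_dist_le_mul fun s t => ?_
        rw [dist_eq_norm, coe_nnnorm, NNReal.dist_eq]
        have h1 := ((hT s u).sub (hT t u)).norm
        refine le_of_tendsto h1 (Eventually.of_forall fun n => (hE_sub n n s t u).trans ?_)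
        rw [← sub_smul, norm_smul, hAval huv, mul_comm, Real.norm_eq_abs]
        exact mul_le_mul_of_nonneg_right ((hJ n).norm_apply_le hacc v) (abs_nonneg _)
      exact hlip.continuous
  have hgen : ∀ u v, (u, v) ∈ S.graph → HasGeneratorValue T u v := by
    intro u v huv
    have hAlim : Tendsto (fun n => A n u) atTop (𝓝 v) := by
      simpa only [hAval huv] using hJlim v
    -- The error is linear in t, so after division by t it is small uniformly in t. This permits
    -- exchanging the limits n → ∞ and t → 0.
    have hET : ∀ n t, ‖E n t u - T t u‖ ≤ (t : ℝ) * ‖A n u - v‖ := by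
      intro n t
      have h1 : Tendsto (fun m => ‖E n t u - E m t u‖) atTop (𝓝 ‖E n t u - T t u‖) :=
        ((hT t u).const_sub _).norm
      have h2 : Tendsto (fun m => (t : ℝ) * ‖A n u - A m u‖) atTop (𝓝 ((t : ℝ) * ‖A n u - v‖)) :=
        ((hAlim.const_sub _).norm).const_mul _
      refine le_of_tendsto_of_tendsto' h1 h2 fun m => (hE_sub n m t t u).trans_eq ?_
      rw [← smul_sub, norm_smul, Real.norm_of_nonneg t.coe_nonneg]
    have hEgen : ∀ n, Tendsto (fun t : ℝ≥0 => (t : ℝ)⁻¹ • (u - E n t u)) (𝓝[>] 0)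
        (𝓝 (A n u)) := by
      intro n
      have h1 := ((hasDerivAt_exp_smul_apply (-A n) u 0).tendsto_slope_zero_right.comp
        tendsto_coe_nhdsGT_zero).neg
      simp only [zero_smul, NormedSpace.exp_zero, one_apply_eq_self, _root_.neg_apply, neg_neg]
        at h1
      refine h1.congr fun t => ?_
      simp only [Function.comp_apply, zero_add, hE]
      rw [← smul_neg, neg_sub, smul_neg]
    rw [HasGeneratorValue, Metric.tendsto_nhds]
    intro ε hε
    obtain ⟨n, hn⟩ := ((tendsto_iff_norm_sub_tendsto_zero.1 hAlim).eventually_lt_const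
      (by positivity : 0 < ε / 3)).exists
    filter_upwards [Metric.tendsto_nhds.1 (hEgen n) (ε / 3) (by positivity),
      self_mem_nhdsWithin] with t ht htpos
    have htpos' : (0 : ℝ) < t := htpos
    have h1 : dist ((t : ℝ)⁻¹ • (u - T t u)) ((t : ℝ)⁻¹ • (u - E n t u)) ≤ ‖A n u - v‖ := by
      rw [dist_eq_norm, ← smul_sub, sub_sub_sub_cancel_left, norm_smul, norm_inv,
        Real.norm_of_nonneg htpos'.le, inv_mul_le_iff₀ htpos']
      exact hET n t
    have := dist_triangle4 ((t : ℝ)⁻¹ • (u - T t u)) ((t : ℝ)⁻¹ • (u - E n t u)) (A n u) v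
    rw [dist_eq_norm (A n u) v] at this
    linarith
  have hTacc : IsAccretive (semigroupGenerator T) :=
    isAccretive_semigroupGenerator hT_norm
  refine ⟨T, hsemi, (LinearPMap.eq_of_eq_graph (le_antisymm ?_ ?_)).symm⟩
  · rintro ⟨u, v⟩ h
    exact mem_graph_semigroupGenerator_iff.2 (hgen u v h)
  -- The generator extends S. The extension is not proper: I + S is already onto and I plus the
  -- generator is injective.
  · rintro ⟨u, v⟩ h
    obtain ⟨x, y, hxy, hsum⟩ := hS.exists_add_smul_eq one_pos (u + ((1 : ℝ) : ℂ) • v)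
    have hxy' := mem_graph_semigroupGenerator_iff.2 (hgen x y hxy)
    obtain rfl := hTacc.eq_of_add_smul_eq zero_le_one hxy' h hsum
    rwa [← LinearPMap.mem_graph_snd_inj _ hxy' h rfl]

end Generation

/-! ### The generator of a contraction semigroup is m-accretive, and the converse sector bound. -/

section ContractionSemigroup

variable {H : Type*} [NormedAddCommGroup H] [InnerProductSpace ℂ H] [CompleteSpace H]

namespace IsC0Semigroup

variable {T : ℝ≥0 → H →L[ℂ] H} {u v : H}

theorem tendsto_average (hT : IsC0Semigroup T) (u : H) :
    Tendsto (fun t : ℝ≥0 => (t : ℝ)⁻¹ • ∫ s in (0 : ℝ)..t, T s.toNNReal u) (𝓝[>] 0) (𝓝 u) := by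
  have h := (((hT.continuous_orbit u).integral_hasStrictDerivAt 0
    0).hasDerivAt.tendsto_slope_zero_right).comp tendsto_coe_nhdsGT_zero
  rw [Real.toNNReal_zero, hT.map_zero, ContinuousLinearMap.id_apply] at h
  simpa only [Function.comp_def, intervalIntegral.integral_same, sub_zero, zero_add] using h

theorem dense_domain_semigroupGenerator (hT : IsC0Semigroup T) :
    Dense ((semigroupGenerator T).domain : Set H) := fun u =>
  mem_closure_of_tendsto (hT.tendsto_average u) <| Eventually.of_forall fun t => by
    rw [SetLike.mem_coe, ← Complex.coe_smul]
    exact Submodule.smul_mem _ _ ⟨_, hT.hasGeneratorValue_integral u t.coe_nonneg⟩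

theorem hasGeneratorValue_of_integral_eq (hT : IsC0Semigroup T)
    (h : ∀ t : ℝ≥0, ∫ s in (0 : ℝ)..t, T s.toNNReal v = u - T t u) : HasGeneratorValue T u v :=
  (hT.tendsto_average v).congr fun t => by rw [h t]

/-- The integrated form of the generator equation describes the graph by conditions continuous in
(u, v). -/
theorem isClosed_semigroupGenerator (hT : IsC0Semigroup T) (hT1 : ∀ t u, ‖T t u‖ ≤ ‖u‖) :
    (semigroupGenerator T).IsClosed := by
  have hgraph : ((semigroupGenerator T).graph : Set (H × H)) =
      ⋂ t : ℝ≥0, {p | ∫ s in (0 : ℝ)..t, T s.toNNReal p.2 = p.1 - T t p.1} := by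
    ext ⟨u, v⟩
    rw [SetLike.mem_coe, mem_graph_semigroupGenerator_iff, Set.mem_iInter]
    refine ⟨fun h t => ?_, fun h => hT.hasGeneratorValue_of_integral_eq h⟩
    simpa using hT.integral_orbit h t.coe_nonneg
  rw [LinearPMap.IsClosed, hgraph]
  refine isClosed_iInter fun t => isClosed_eq ?_
    (continuous_fst.sub ((T t).continuous.comp continuous_fst))
  have hlip : LipschitzWith t fun w : H => ∫ s in (0 : ℝ)..t, T s.toNNReal w := by
    refine LipschitzWith.of_dist_le_mul fun x y => ?_
    rw [dist_eq_norm, ← intervalIntegral.integral_sub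
      ((hT.continuous_orbit x).intervalIntegrable _ _)
      ((hT.continuous_orbit y).intervalIntegrable _ _)]
    refine (intervalIntegral.norm_integral_le_of_norm_le_const (C := dist x y)
      fun s _ => ?_).trans_eq ?_
    · rw [← map_sub, dist_eq_norm]
      exact hT1 _ _
    · rw [sub_zero, abs_of_nonneg t.coe_nonneg, mul_comm]
  exact hlip.continuous.comp continuous_snd

/-- Averages of the orbit of y lie in the domain of S and tend to y. Pairing S*y with such an
average moves S onto it, leaving t⁻¹(y, y - T(t)y), whose real part is nonnegative. -/
theorem isAccretive_adjoint_semigroupGenerator (hT : IsC0Semigroup T)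
    (hT1 : ∀ t u, ‖T t u‖ ≤ ‖u‖) : IsAccretive (semigroupGenerator T).adjoint := by
  intro y
  set w := (semigroupGenerator T).adjoint y
  have havg := Tendsto.inner (𝕜 := ℂ) (tendsto_const_nhds (x := w)) (hT.tendsto_average (y : H))
  have hre := (Complex.continuous_re.tendsto _).comp havg
  rw [← inner_conj_symm, Complex.conj_re]
  refine ge_of_tendsto' hre fun t => ?_
  have hgen := hT.hasGeneratorValue_integral (y : H) t.coe_nonneg
  obtain ⟨x, hx, hSx⟩ := (LinearPMap.mem_graph_iff _).1 (mem_graph_semigroupGenerator_iff.2 hgen)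
  have hadj := LinearPMap.adjoint_isFormalAdjoint hT.dense_domain_semigroupGenerator y x
  dsimp only at hx hSx
  rw [hx, hSx, Real.toNNReal_coe] at hadj
  rw [Function.comp_apply, inner_smul_right_eq_smul, hadj, Complex.smul_re]
  exact mul_nonneg (inv_nonneg.2 t.coe_nonneg) (re_inner_sub_apply_nonneg (hT1 t y))

theorem isMAccretive_semigroupGenerator (hT : IsC0Semigroup T) (hT1 : ∀ t u, ‖T t u‖ ≤ ‖u‖) :
    IsMAccretive (semigroupGenerator T) where
  accretive := isAccretive_semigroupGenerator hT1
  dense_domain := hT.dense_domain_semigroupGenerator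
  closed := hT.isClosed_semigroupGenerator hT1
  adjoint_accretive := hT.isAccretive_adjoint_semigroupGenerator hT1

end IsC0Semigroup

theorem abs_im_inner_le_of_eventually_mem_classC {T : ℝ≥0 → H →L[ℂ] H} {α : ℝ} (hα₀ : 0 ≤ α)
    (hα₁ : α < Real.pi / 2) (hT1 : ∀ t, ‖T t‖ ≤ 1) (hT : ∀ᶠ t in 𝓝 (0 : ℝ≥0), T t ∈ classC α)
    {u v : H} (h : HasGeneratorValue T u v) :
    |(inner ℂ u v).im| ≤ Real.tan α * (inner ℂ u v).re := by
  have hk : 0 ≤ Real.tan α := Real.tan_nonneg_of_nonneg_of_le_pi_div_two hα₀ hα₁.le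
  have hlim := h.tendsto_inner u
  refine le_of_tendsto_of_tendsto ((Complex.continuous_im.tendsto _).comp hlim).abs
    (((Complex.continuous_re.tendsto _).comp hlim).const_mul (Real.tan α)) ?_
  filter_upwards [nhdsWithin_le_nhds hT] with t ht
  have hle := abs_im_inner_sub_apply_le hk ((mem_classC_iff hα₀ hα₁ (hT1 t)).1 ht u)
  have ht0 : (0 : ℝ) ≤ (t : ℝ)⁻¹ := inv_nonneg.2 t.coe_nonneg
  simp only [Function.comp_apply]
  rw [Complex.smul_im, Complex.smul_re, smul_eq_mul, smul_eq_mul, abs_mul, abs_of_nonneg ht0,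
    mul_left_comm]
  exact mul_le_mul_of_nonneg_left hle ht0

end ContractionSemigroup

theorem theorem2p1 {H : Type*} [NormedAddCommGroup H] [InnerProductSpace ℂ H] [CompleteSpace H]
    (α : ℝ) (hα₀ : 0 ≤ α) (hα₁ : α < Real.pi / 2) :
    (∀ S : H →ₗ.[ℂ] H, IsMSectorial α S →
      (∃! T : ℝ≥0 → H →L[ℂ] H, IsC0Semigroup T ∧ semigroupGenerator T = S) ∧
      ∀ T : ℝ≥0 → H →L[ℂ] H, IsC0Semigroup T → semigroupGenerator T = S →
        ∀ t : ℝ≥0, T t ∈ classC α) ∧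
    (∀ T : ℝ≥0 → H →L[ℂ] H, IsC0Semigroup T → (∀ t : ℝ≥0, ‖T t‖ ≤ 1) →
      (∀ᶠ t in 𝓝 (0 : ℝ≥0), T t ∈ classC α) →
      IsMSectorial α (semigroupGenerator T)) := by
  refine ⟨fun S hS => ⟨?_, ?_⟩, fun T hT hT1 hTα => ?_⟩
  · obtain ⟨T, hT, rfl⟩ := hS.mAccretive.exists_isC0Semigroup
    exact ⟨T, ⟨hT, rfl⟩, fun U ⟨hU, hUT⟩ => (hT.ext_of_semigroupGenerator_eq hU hUT.symm
      hS.mAccretive.accretive hS.mAccretive.dense_domain).symm⟩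
  · rintro T hT rfl t
    exact hT.mem_classC hα₀ hα₁ hS t
  · have hacc := hT.isMAccretive_semigroupGenerator fun t u => by
      simpa using (T t).le_of_opNorm_le (hT1 t) u
    refine ⟨hacc, (hacc.accretive.numRange_subset_closedSector_iff hα₀ hα₁).2 fun u => ?_⟩
    exact abs_im_inner_le_of_eventually_mem_classC hα₀ hα₁ hT1 hTα
      (hasGeneratorValue_semigroupGenerator T u)
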